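/- **Theorem 3.8 (Hermitian LCD constacyclic codes).** Let $q$ be a prime power, $\mathbb F_{q^2}$ the field with $q^2$ elements, $n$ a positive integer with $\gcd(n,q)=1$, and $\lambda\in\mathbb F_{q^2}^{*}$ of multiplicative order $r$. A $\lambda$-constacyclic code of length $n$ is a linear subspace $C\subseteq\mathbb F_{q^2}^n$ such that $(c_0,c_1,\dots,c_{n-1})\in C$ implies $(\lambda c_{n-1},c_0,\dots,c_{n-2})\in C$. It is Hermitian LCD if $C\cap C^{\perp_H}=\{0\}$, where $C^{\perp_H}=\{u\in\mathbb F_{q^2}^n : \sum_{i=0}^{n-1}u_iv_i^q=0 \text{ for all } v\in C\}$. (1) If $\lambda^{q+1}\neq 1$, then every $\lambda$-constacyclic code of length $n$ over $\mathbb F_{q^2}$ is Hermitian LCD. (2) Suppose $\lambda^{q+1}=1$, and write $n=n_1n_2$ with $\operatorname{rad}(n_1)\mid\operatorname{rad}(r)$ and $\gcd(n_2,r)=1$, where $\operatorname{rad}(m)$ is the product of the distinct primes dividing $m$. Then the number of Hermitian LCD $\lambda$-constacyclic codes of length $n$ over $\mathbb F_{q^2}$ (the zero code included) is exactly $$2^{\frac{M_1+M_2}{2}},\qquad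 M_1=n_1\sum_{d\mid n_2}\frac{\phi(d)}{\operatorname{ord}_{rdn_1}(q^2)},\qquad M_2=n_1\sum_{d\in T(n,r)}\frac{\phi(d)}{\operatorname{ord}_{rdn_1}(q^2)},$$ where $T(n,r)$ is the set of all $d\mid n_2$ such that $q^w\equiv-1\pmod{rdn_1}$ for some odd positive integer $w$, $\operatorname{ord}_m(a)$ is the multiplicative order of $a$ modulo $m$, and $\phi$ is Euler's function. -/

import Mathlib

/-- The `a`-constacyclic shift
`(c₀, c₁, …, cₙ₋₁) ↦ (a cₙ₋₁, c₀, …, cₙ₋₂)` on words of length `n`. -/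
def constacyclicShift {F : Type*} [Field F] {n : ℕ} (a : F) (c : Fin n → F) : Fin n → F :=
  fun i => if (i : ℕ) = 0 then a * c ⟨n - 1, by have := i.isLt; omega⟩
    else c ⟨(i : ℕ) - 1, by have := i.isLt; omega⟩

/-- A linear code `C ⊆ Fⁿ` is `a`-constacyclic if it is closed under the `a`-constacyclic shift.
Under `c ↦ c₀ + c₁ x + ⋯ + cₙ₋₁ xⁿ⁻¹` the shift is multiplication by `x` modulo `xⁿ - a`, so these
are exactly the ideals of `F[x] / (xⁿ - a)`. -/
def IsConstacyclic {F : Type*} [Field F] {n : ℕ} (a : F) (C : Submodule F (Fin n → F)) : Prop :=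
  ∀ c ∈ C, constacyclicShift a c ∈ C

/-- The Hermitian inner product `∑ xᵢ yᵢ^q` on `Fⁿ`, where `F` has `q²` elements. -/
def hermitianInner {F : Type*} [Field F] {n : ℕ} (q : ℕ) (x y : Fin n → F) : F :=
  ∑ i, x i * y i ^ q

/-- The Hermitian dual code `{u | ⟨u, v⟩_H = 0 for all v ∈ C}`. -/
def hermitianDual {F : Type*} [Field F] {n : ℕ} (q : ℕ) (C : Submodule F (Fin n → F)) :
    Submodule F (Fin n → F) where
  carrier := {u | ∀ v ∈ C, hermitianInner q u v = 0}
  zero_mem' := by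
    intro v _
    simp [hermitianInner]
  add_mem' := by
    intro a b ha hb v hv
    have h1 := ha v hv
    have h2 := hb v hv
    simp only [hermitianInner] at h1 h2 ⊢
    simp [add_mul, Finset.sum_add_distrib, h1, h2]
  smul_mem' := by
    intro t a ha v hv
    have h1 := ha v hv
    simp only [hermitianInner] at h1 ⊢
    simp [mul_assoc, ← Finset.mul_sum, h1]

/-- `C` is Hermitian LCD (linear complementary dual): `C ∩ C^{⊥_H} = {0}`. -/
def IsHermitianLCD {F : Type*} [Field F] {n : ℕ} (q : ℕ) (C : Submodule F (Fin n → F)) : Prop :=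
  C ⊓ hermitianDual q C = ⊥

/-- The set `T` of the divisors `d` of `n₂` for which `q^w ≡ -1 (mod r d n₁)` for some odd
positive integer `w`. -/
noncomputable def oddDivisorSet (q r n₁ n₂ : ℕ) : Finset ℕ :=
  open Classical in
  n₂.divisors.filter fun d => ∃ w : ℕ, Odd w ∧ (q : ℤ) ^ w ≡ -1 [ZMOD ((r * d * n₁ : ℕ) : ℤ)]

/-- `M₁ = n₁ ∑_{d ∣ n₂} φ(d) / ord_{r d n₁}(q²)`, a rational number (single summands need not be
integers). -/
noncomputable def countM1 (q r n₁ n₂ : ℕ) : ℚ :=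
  n₁ * ∑ d ∈ n₂.divisors, (Nat.totient d : ℚ) / orderOf ((q : ZMod (r * d * n₁)) ^ 2)

/-- `M₂ = n₁ ∑_{d ∈ T} φ(d) / ord_{r d n₁}(q²)`, with `T` the set `oddDivisorSet q r n₁ n₂`. -/
noncomputable def countM2 (q r n₁ n₂ : ℕ) : ℚ :=
  n₁ * ∑ d ∈ oddDivisorSet q r n₁ n₂,
    (Nat.totient d : ℚ) / orderOf ((q : ZMod (r * d * n₁)) ^ 2)

/-!
Let `K` be an algebraic closure of `F` and let `X` be the set of the `n` distinct `n`-th roots of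
`λ` in `K`. Evaluating a word `c`, read as the polynomial `∑ cᵢ xⁱ`, at the points of `X` is a
discrete Fourier transform: it is injective, turns the constacyclic shift into multiplication by
the coordinate `β`, and its image contains the indicator function of every subset of `X` stable
under the Frobenius map `β ↦ β ^ (q²)` (`exists_wordEval_eq_indicator`). Since `F[x]` is a
principal ideal ring and `xⁿ - λ` is separable, a constacyclic code consists of all words whose
transform vanishes off some Frobenius-stable `U ⊆ X` (`IsConstacyclic.eq_codeOfSupport`), and `U`
is determined by the code (`codeOfSupport_injOn`).

When `λ ^ (q + 1) = 1`, the map `σ β = β ^ (-q)` permutes `X`, its square is the Frobenius map, and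
Parseval's identity reads `n ⟨u, v⟩ = ∑ û(σ β) v̂(β) ^ q` (`natCast_mul_hermitianInner`). Hence the
dual of the code with support `U` consists of the words with transform vanishing on `σ U`, and the
code is Hermitian LCD if and only if `U` is stable under `σ`. The number of such `U` is `2` to the
number of orbits of `σ`. That number is `∑_β 1 / |orbit of β|`, and the orbit of an element `β` of
order `m` has as many elements as the order of `-q` modulo `m`. There are `n₁ φ(d)` elements of
order `r d n₁` in `X` for every `d ∣ n₂` and no others (`UnitRoots.sum_orderOf`). Finally the order
of `q² = (-q)²` is that of `-q` if the latter is odd, which is to say that `q ^ w ≡ -1` for an odd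
`w`, and half of it otherwise (`inv_orderOf_neg_natCast`); this gives `(M₁ + M₂) / 2` orbits.

When `λ ^ (q + 1) ≠ 1`, the shift `T` satisfies
`⟨T u, T v⟩ = ⟨u, v⟩ + (λ ^ (q + 1) - 1) uₙ₋₁ vₙ₋₁ ^ q`. A word of `D = C ∩ C^⊥` remains in `D`
under `T` if its last entry is `0`, and under `T⁻¹` if its first entry is `0`. So if `D ≠ 0`, it
contains a word `d` with nonzero last entry and a word `e = T w` with nonzero first entry, and
then `⟨T d, e⟩` vanishes because `e ∈ C^⊥` but not according to the formula.
-/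

/-! ### Codes with `λ ^ (q + 1) ≠ 1` -/

theorem constacyclicShift_zero {F : Type*} [Field F] {m : ℕ} (a : F) (c : Fin (m + 1) → F) :
    constacyclicShift a c 0 = a * c (Fin.last m) := by
  simp [constacyclicShift, Fin.last]

theorem constacyclicShift_succ {F : Type*} [Field F] {m : ℕ} (a : F) (c : Fin (m + 1) → F)
    (i : Fin m) :
    constacyclicShift a c i.succ = c i.castSucc := by
  simp [constacyclicShift, Fin.castSucc, Fin.castAdd, Fin.castLE]

theorem hermitianInner_constacyclicShift {F : Type*} [Field F] {m : ℕ} (q : ℕ) (a : F)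
    (u v : Fin (m + 1) → F) :
    hermitianInner q (constacyclicShift a u) (constacyclicShift a v) =
      hermitianInner q u v + (a ^ (q + 1) - 1) * (u (Fin.last m) * v (Fin.last m) ^ q) := by
  rw [hermitianInner, hermitianInner, Fin.sum_univ_succ, Fin.sum_univ_castSucc]
  simp only [constacyclicShift_zero, constacyclicShift_succ]
  ring

theorem hermitianInner_pow {F : Type*} [Field F] [Fintype F] {n p k q : ℕ} [ExpChar F p]
    (hq : q = p ^ k) (hF : Fintype.card F = q ^ 2) (u v : Fin n → F) :
    hermitianInner q u v ^ q = hermitianInner q v u := by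
  have h := map_sum (iterateFrobenius F p k) (fun i => u i * v i ^ q) Finset.univ
  simp only [iterateFrobenius_def, ← hq] at h
  rw [hermitianInner, h]
  refine Finset.sum_congr rfl fun i _ => ?_
  rw [mul_pow, ← pow_mul, ← sq, ← hF, FiniteField.pow_card, mul_comm]

/-- The defect of unitarity of the shift excludes nonzero words in `C ∩ C^⊥`: otherwise, shifting
within `C ∩ C^⊥` would produce a word with nonzero last entry and one with nonzero first entry. -/
theorem isHermitianLCD_of_pow_ne_one {F : Type*} [Field F] [Fintype F] {m p k q : ℕ} [ExpChar F p]
    (hq : q = p ^ k) (hF : Fintype.card F = q ^ 2) {a : F} (ha0 : a ≠ 0) (ha : a ^ (q + 1) ≠ 1)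
    {C : Submodule F (Fin (m + 1) → F)} (hC : IsConstacyclic a C) : IsHermitianLCD q C := by
  have hq0 : q ≠ 0 := by
    rintro rfl
    exact Fintype.card_ne_zero hF
  have hsurj (c : Fin (m + 1) → F) (hc : c ∈ C) : ∃ d ∈ C, constacyclicShift a d = c := by
    let T : C → C := fun c => ⟨constacyclicShift a c, hC c c.2⟩
    have hT : Function.Injective T := by
      intro c d h
      have h' : constacyclicShift a (c : Fin (m + 1) → F) = constacyclicShift a d :=
        congrArg Subtype.val h
      ext i
      induction i using Fin.lastCases with
      | last =>
        have h0 := congrFun h' 0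
        rw [constacyclicShift_zero, constacyclicShift_zero] at h0
        exact mul_left_cancel₀ ha0 h0
      | cast i =>
        have hi := congrFun h' i.succ
        rwa [constacyclicShift_succ, constacyclicShift_succ] at hi
    obtain ⟨d, hd⟩ := Finite.surjective_of_injective hT ⟨c, hc⟩
    exact ⟨d, d.2, congrArg Subtype.val hd⟩
  -- A word of `C ∩ C^⊥` with last entry `0` may be shifted forwards within `C ∩ C^⊥`.
  have hup (i : Fin (m + 1)) : ∀ c ∈ C ⊓ hermitianDual q C, c i ≠ 0 →
      ∃ d ∈ C ⊓ hermitianDual q C, d (Fin.last m) ≠ 0 := by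
    induction i using Fin.reverseInduction with
    | last => exact fun c hc h => ⟨c, hc, h⟩
    | cast i ih =>
      intro c hc h
      by_cases hl : c (Fin.last m) = 0
      · refine ih (constacyclicShift a c) ⟨hC c hc.1, fun v hv => ?_⟩
          (by rwa [constacyclicShift_succ])
        obtain ⟨w, hw, rfl⟩ := hsurj v hv
        rw [hermitianInner_constacyclicShift, hl, zero_mul, mul_zero, add_zero]
        exact hc.2 w hw
      · exact ⟨c, hc, hl⟩
  -- A word of `C ∩ C^⊥` with first entry `0` may be shifted backwards within `C ∩ C^⊥`.
  have hdown (i : Fin (m + 1)) : ∀ c ∈ C ⊓ hermitianDual q C, c i ≠ 0 →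
      ∃ d ∈ C ⊓ hermitianDual q C, d 0 ≠ 0 := by
    induction i using Fin.induction with
    | zero => exact fun c hc h => ⟨c, hc, h⟩
    | succ i ih =>
      intro c hc h
      by_cases h0 : c 0 = 0
      · obtain ⟨d, hd, rfl⟩ := hsurj c hc.1
        rw [constacyclicShift_succ] at h
        rw [constacyclicShift_zero] at h0
        refine ih d ⟨hd, fun v hv => ?_⟩ h
        have hv' := hc.2 _ (hC v hv)
        rwa [hermitianInner_constacyclicShift, (mul_eq_zero.1 h0).resolve_left ha0, zero_mul,
          mul_zero, add_zero] at hv'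
      · exact ⟨c, hc, h0⟩
  rw [IsHermitianLCD, Submodule.eq_bot_iff]
  intro c hc
  by_contra hne
  obtain ⟨i, hi⟩ := Function.ne_iff.1 hne
  obtain ⟨d, hd, hd0⟩ := hup i c hc hi
  obtain ⟨e, he, he0⟩ := hdown i c hc hi
  obtain ⟨w, hw, rfl⟩ := hsurj e he.1
  -- The left side of the shift formula for `d` and `w` is `0`, and so is `⟨d, w⟩`.
  have h := hermitianInner_constacyclicShift q a d w
  rw [← hermitianInner_pow hq hF, he.2 _ (hC d hd.1), zero_pow hq0, hd.2 w hw, zero_add] at h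
  rw [constacyclicShift_zero] at he0
  exact mul_ne_zero (sub_ne_zero.2 ha) (mul_ne_zero hd0 (pow_ne_zero q (right_ne_zero_of_mul he0)))
    h.symm

/-! ### Roots of a unit and the Fourier transform of words -/

/-- The type of the `n`-th roots of a unit `b` of `K`, as units of `K`. For `n > 0`
these are all the roots of `xⁿ - b` in `K`. -/
abbrev UnitRoots {K : Type*} [Field K] (n : ℕ) (b : Kˣ) : Type _ := {u : Kˣ // u ^ n = b}

section
variable {F K : Type*} [Field F] [Field K] [Algebra F K] {n : ℕ} {b : Kˣ}

instance UnitRoots.instFinite [NeZero n] : Finite (UnitRoots n b) := by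
  classical
  refine Set.Finite.to_subtype (s := {u : Kˣ | u ^ n = b}) ?_
  refine Set.Finite.of_finite_image (f := ((↑) : Kˣ → K)) ?_ Units.val_injective.injOn
  refine (Polynomial.nthRoots n (b : K)).toFinset.finite_toSet.subset ?_
  rintro _ ⟨u, hu, rfl⟩
  simp only [Set.mem_ofPred_eq] at hu
  simp [Polynomial.mem_nthRoots (NeZero.pos n), ← hu]

noncomputable instance UnitRoots.instFintype [NeZero n] : Fintype (UnitRoots n b) :=
  Fintype.ofFinite _

theorem UnitRoots.card_eq [IsAlgClosed K] (hn : (n : K) ≠ 0) :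
    Nat.card (UnitRoots n b) = n := by
  have : NeZero (n : K) := ⟨hn⟩
  have : NeZero n := NeZero.of_neZero_natCast K
  obtain ⟨z, hz⟩ := IsAlgClosed.exists_pow_nat_eq (b : K) (NeZero.pos n)
  have hz0 : z ≠ 0 := by
    rintro rfl
    exact b.ne_zero (by rw [← hz, zero_pow (NeZero.ne n)])
  let u : Kˣ := Units.mk0 z hz0
  have hu : u ^ n = b := Units.ext hz
  refine (Nat.card_congr ?_).trans (HasEnoughRootsOfUnity.natCard_rootsOfUnity K n)
  exact
    { toFun v := ⟨v.1 * u⁻¹, by rw [mem_rootsOfUnity, mul_pow, inv_pow, hu, v.2, mul_inv_cancel]⟩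
      invFun w := ⟨w.1 * u, by rw [mul_pow, hu, (mem_rootsOfUnity _ _).1 w.2, one_mul]⟩
      left_inv v := by ext; simp
      right_inv w := by ext; simp }

/-- Multiplication by a primitive `n`-th root of unity `ζ` permutes the roots and multiplies the sum
by `ζ ^ k ≠ 1`. -/
theorem UnitRoots.sum_zpow_eq_zero [IsAlgClosed K] [NeZero n] (hn : (n : K) ≠ 0) {k : ℤ}
    (hk : ¬ (n : ℤ) ∣ k) : ∑ β : UnitRoots n b, ((β.1 ^ k : Kˣ) : K) = 0 := by
  have : NeZero (n : K) := ⟨hn⟩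
  obtain ⟨ζ', hζ'⟩ := HasEnoughRootsOfUnity.exists_primitiveRoot K n
  obtain ⟨ζ, rfl⟩ := hζ'.isUnit (NeZero.ne n)
  have hζ : IsPrimitiveRoot ζ n := IsPrimitiveRoot.coe_units_iff.1 hζ'
  let τ : Equiv.Perm (UnitRoots n b) :=
    { toFun v := ⟨v.1 * ζ, by rw [mul_pow, hζ.pow_eq_one, v.2, mul_one]⟩
      invFun v := ⟨v.1 * ζ⁻¹, by rw [mul_pow, inv_pow, hζ.pow_eq_one, v.2, inv_one, mul_one]⟩
      left_inv v := by ext; simp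
      right_inv w := by ext; simp }
  have h := Equiv.sum_comp τ fun β : UnitRoots n b => ((β.1 ^ k : Kˣ) : K)
  simp only [τ, Equiv.coe_fn_mk, mul_zpow, Units.val_mul, ← Finset.sum_mul] at h
  have h1 : ((ζ ^ k : Kˣ) : K) ≠ 1 := fun h1 =>
    hk ((hζ.zpow_eq_one_iff_dvd k).1 (Units.ext h1))
  by_contra h0
  exact h1 (mul_left_cancel₀ h0 (h.trans (mul_one _).symm))

theorem UnitRoots.sum_pow_div_pow [IsAlgClosed K] [NeZero n] (hn : (n : K) ≠ 0) (i j : Fin n) :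
    ∑ β : UnitRoots n b, ((β.1 : K) ^ (i : ℕ) / (β.1 : K) ^ (j : ℕ)) =
      if i = j then (n : K) else 0 := by
  split_ifs with h
  · subst h
    simp only [div_self (pow_ne_zero _ (Units.ne_zero _)), Finset.sum_const, Finset.card_univ,
      ← Nat.card_eq_fintype_card, UnitRoots.card_eq hn, nsmul_eq_mul, mul_one]
  · rw [← UnitRoots.sum_zpow_eq_zero (b := b) hn (k := (i : ℤ) - j)]
    · refine Finset.sum_congr rfl fun β _ => ?_
      rw [zpow_sub]
      simp [div_eq_mul_inv]
    · intro hd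
      apply h
      have := Int.eq_zero_of_abs_lt_dvd hd (by have := i.2; have := j.2; rw [abs_lt]; omega)
      ext; omega

open Classical in
theorem UnitRoots.sum_index_pow_div_pow (β γ : UnitRoots n b) :
    ∑ i : Fin n, ((β.1 : K) ^ (i : ℕ) / (γ.1 : K) ^ (i : ℕ)) = if β = γ then (n : K) else 0 := by
  simp only [← div_pow]
  rw [Fin.sum_univ_eq_sum_range (fun i => ((β.1 : K) / (γ.1 : K)) ^ i)]
  split_ifs with h
  · subst h
    simp
  · have h1 : (β.1 : K) / γ.1 ≠ 1 := fun h1 =>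
      h (Subtype.ext (Units.ext ((div_eq_one_iff_eq (Units.ne_zero _)).1 h1)))
    rw [geom_sum_eq h1, div_pow, ← Units.val_pow_eq_pow_val, ← Units.val_pow_eq_pow_val, β.2, γ.2,
      div_self (Units.ne_zero _), sub_self, zero_div]

/-- The value at `x` of the polynomial `∑ cᵢ xⁱ` attached to a word `c`, as a linear map in `c`. The
family of these values over `x : UnitRoots n b` is the Fourier transform of `c`. -/
def wordEval (x : K) : (Fin n → F) →ₗ[F] K :=
  ∑ i : Fin n, (LinearMap.proj i : (Fin n → F) →ₗ[F] F).smulRight (x ^ (i : ℕ))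

theorem wordEval_apply (x : K) (c : Fin n → F) :
    wordEval x c = ∑ i, algebraMap F K (c i) * x ^ (i : ℕ) := by
  simp [wordEval, Algebra.smul_def]

theorem wordEval_constacyclicShift {a : F} {x : K} (hx : x ^ n = algebraMap F K a)
    (c : Fin n → F) : wordEval x (constacyclicShift a c) = x * wordEval x c := by
  cases n with
  | zero => simp [wordEval_apply]
  | succ m =>
    rw [wordEval_apply, wordEval_apply, Fin.sum_univ_succ, Fin.sum_univ_castSucc, mul_add,
      Finset.mul_sum, add_comm]
    congr 1
    · refine Finset.sum_congr rfl fun i _ => ?_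
      rw [constacyclicShift_succ, Fin.val_succ, Fin.val_castSucc, pow_succ]
      ring
    · rw [constacyclicShift_zero, map_mul, ← hx]
      simp only [Fin.val_zero, Fin.val_last]
      ring

/-- Fourier inversion. -/
theorem natCast_mul_coeff_eq_sum_wordEval [IsAlgClosed K] [NeZero n] (hn : (n : K) ≠ 0)
    (c : Fin n → F) (j : Fin n) :
    (n : K) * algebraMap F K (c j) =
      ∑ β : UnitRoots n b, wordEval (β.1 : K) c / (β.1 : K) ^ (j : ℕ) := by
  simp only [wordEval_apply, Finset.sum_div, mul_div_assoc]
  rw [Finset.sum_comm]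
  simp only [← Finset.mul_sum, UnitRoots.sum_pow_div_pow hn]
  simp [mul_comm]

variable (b) in
theorem eq_of_wordEval_eq [IsAlgClosed K] [NeZero n] (hn : (n : K) ≠ 0) {c c' : Fin n → F}
    (h : ∀ β : UnitRoots n b, wordEval (β.1 : K) c = wordEval (β.1 : K) c') : c = c' := by
  ext j
  apply (algebraMap F K).injective
  apply mul_left_cancel₀ hn
  rw [natCast_mul_coeff_eq_sum_wordEval (b := b) hn, natCast_mul_coeff_eq_sum_wordEval (b := b) hn]
  simp only [h]

end


/-- Otherwise `x ^ |F| - x` would have `|F| + 1` roots, namely `y` and the elements of `F`. -/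
theorem FiniteField.mem_range_algebraMap_of_pow_card_eq {F K : Type*} [Field F] [Fintype F]
    [Field K] [Algebra F K] {y : K} (hy : y ^ Fintype.card F = y) :
    y ∈ Set.range (algebraMap F K) := by
  by_contra hmem
  -- `y` and the elements of `F`, all of them roots.
  let r : Option F → K := fun o => o.elim y (algebraMap F K)
  have hr : Function.Injective r := by
    rintro (_ | s) (_ | t) h
    · rfl
    · exact absurd ⟨t, h.symm⟩ hmem
    · exact absurd ⟨s, h⟩ hmem
    · exact congrArg some ((algebraMap F K).injective h)
  refine FiniteField.X_pow_card_sub_X_ne_zero K (Fintype.one_lt_card (α := F))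
    (Polynomial.eq_zero_of_natDegree_lt_card_of_eval_eq_zero _ hr ?_ ?_)
  · rintro (_ | s)
    · simp [r, hy]
    · simp [r, ← map_pow, FiniteField.pow_card]
  · rw [FiniteField.X_pow_card_sub_X_natDegree_eq K Fintype.one_lt_card, Fintype.card_option]
    exact Nat.lt_succ_self _

section
variable {F K : Type*} [Field F] [Fintype F] [Field K] [Algebra F K] {n : ℕ} {b : Kˣ}

theorem FiniteField.sum_pow_card {ι : Type*} (s : Finset ι) (f : ι → K) :
    (∑ i ∈ s, f i) ^ Fintype.card F = ∑ i ∈ s, f i ^ Fintype.card F :=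
  map_sum (FiniteField.frobeniusAlgHom F K) f s

theorem wordEval_pow_card (x : K) (c : Fin n → F) :
    wordEval (x ^ Fintype.card F) c = wordEval x c ^ Fintype.card F := by
  simp only [wordEval_apply, FiniteField.sum_pow_card, mul_pow, ← map_pow, FiniteField.pow_card,
    pow_right_comm]

open Classical in
/-- The word is the inverse Fourier transform of the indicator function of `U`. Its entries lie in
`F` because the Frobenius map permutes the summands. -/
theorem exists_wordEval_eq_indicator [NeZero n] (hn : (n : K) ≠ 0)
    {τ : Equiv.Perm (UnitRoots n b)} (hτ : ∀ β, (τ β).1 = β.1 ^ Fintype.card F)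
    {U : Set (UnitRoots n b)} (hU : ∀ β, τ β ∈ U ↔ β ∈ U) :
    ∃ e : Fin n → F, ∀ β : UnitRoots n b, wordEval (β.1 : K) e = if β ∈ U then 1 else 0 := by
  let E : Fin n → K := fun i => (n : K)⁻¹ * ∑ γ : UnitRoots n b,
    if γ ∈ U then ((γ.1 : K) ^ (i : ℕ))⁻¹ else 0
  have hE (i : Fin n) : E i ∈ Set.range (algebraMap F K) := by
    apply FiniteField.mem_range_algebraMap_of_pow_card_eq
    have h := map_natCast (FiniteField.frobeniusAlgHom F K) n
    rw [FiniteField.coe_frobeniusAlgHom] at h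
    simp only [E, mul_pow, inv_pow, FiniteField.sum_pow_card] at h ⊢
    rw [h]
    congr 1
    refine Eq.trans ?_ (Equiv.sum_comp τ _)
    refine Finset.sum_congr rfl fun γ _ => ?_
    simp only [hU, hτ]
    split_ifs
    · rw [inv_pow, Units.val_pow_eq_pow_val, pow_right_comm]
    · exact zero_pow Fintype.card_ne_zero
  choose e he using hE
  refine ⟨e, fun β => ?_⟩
  have h (γ : UnitRoots n b) : (if γ ∈ U then ∑ i : Fin n,
      ((β.1 : K) ^ (i : ℕ) / (γ.1 : K) ^ (i : ℕ)) else 0) =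
      if γ = β then (if β ∈ U then (n : K) else 0) else 0 := by
    rw [UnitRoots.sum_index_pow_div_pow]
    by_cases hγ : γ = β
    · subst hγ; simp
    · simp [hγ, Ne.symm hγ]
  calc wordEval (β.1 : K) e
      = (n : K)⁻¹ * ∑ γ : UnitRoots n b, (if γ ∈ U then ∑ i : Fin n,
          ((β.1 : K) ^ (i : ℕ) / (γ.1 : K) ^ (i : ℕ)) else 0) := by
        simp only [wordEval_apply, he, E, mul_assoc, ← Finset.mul_sum, Finset.sum_mul]
        rw [Finset.sum_comm]
        congr 1
        refine Finset.sum_congr rfl fun γ _ => ?_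
        split_ifs
        · exact Finset.sum_congr rfl fun i _ => by rw [div_eq_mul_inv, mul_comm]
        · simp
    _ = if β ∈ U then 1 else 0 := by
        simp only [h, Finset.sum_ite_eq', Finset.mem_univ, if_true]
        split_ifs
        · exact inv_mul_cancel₀ hn
        · exact mul_zero _

end

section
variable {F K : Type*} [Field F] [Field K] [Algebra F K] {n : ℕ} {a : F} {b : Kˣ}

/-- The code of all words whose Fourier transform vanishes off `U`; its words are the multiples of
the polynomial with root set `Uᶜ` once `U` is stable under the Frobenius map. -/
def codeOfSupport (F : Type*) [Field F] [Algebra F K] (U : Set (UnitRoots n b)) :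
    Submodule F (Fin n → F) :=
  ⨅ β ∈ Uᶜ, LinearMap.ker (wordEval (β.1 : K))

theorem mem_codeOfSupport {U : Set (UnitRoots n b)} {c : Fin n → F} :
    c ∈ codeOfSupport F U ↔ ∀ β ∉ U, wordEval (β.1 : K) c = 0 := by
  simp [codeOfSupport, Submodule.mem_iInf]

theorem UnitRoots.pow_eq (hb : (b : K) = algebraMap F K a) (β : UnitRoots n b) :
    (β.1 : K) ^ n = algebraMap F K a :=
  (congrArg Units.val β.2).trans hb

theorem isConstacyclic_codeOfSupport (hb : (b : K) = algebraMap F K a)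
    (U : Set (UnitRoots n b)) : IsConstacyclic a (codeOfSupport F U) := by
  intro c hc
  rw [mem_codeOfSupport] at hc ⊢
  intro β hβ
  rw [wordEval_constacyclicShift (UnitRoots.pow_eq hb β), hc β hβ, mul_zero]

theorem X_pow_sub_C_dvd_of_aeval_eq_zero [IsAlgClosed K] [NeZero n] (hn : (n : K) ≠ 0)
    (hb : (b : K) = algebraMap F K a) {p : Polynomial F}
    (hp : ∀ β : UnitRoots n b, Polynomial.aeval (β.1 : K) p = 0) :
    Polynomial.X ^ n - Polynomial.C a ∣ p := by
  have hmonic := Polynomial.monic_X_pow_sub_C a (NeZero.ne n)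
  rw [← Polynomial.modByMonic_eq_zero_iff_dvd hmonic]
  rw [← Polynomial.map_eq_zero_iff (algebraMap F K).injective]
  refine Polynomial.eq_zero_of_natDegree_lt_card_of_eval_eq_zero _
    (f := fun β : UnitRoots n b => (β.1 : K))
    (Units.val_injective.comp Subtype.val_injective) (fun β => ?_) ?_
  · rw [Polynomial.eval_map_algebraMap, Polynomial.aeval_modByMonic_eq_self_of_root, hp]
    simp [UnitRoots.pow_eq hb β]
  · rw [← Nat.card_eq_fintype_card, UnitRoots.card_eq hn, Polynomial.natDegree_map]
    have := Polynomial.natDegree_modByMonic_lt p hmonic (by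
      intro h
      have h' := congrArg Polynomial.natDegree h
      rw [Polynomial.natDegree_X_pow_sub_C, Polynomial.natDegree_one] at h'
      exact NeZero.ne n h')
    rwa [Polynomial.natDegree_X_pow_sub_C] at this

/-- The constacyclic shift as an endomorphism of `Fⁿ`. -/
def constacyclicShiftLin (n : ℕ) (a : F) : Module.End F (Fin n → F) where
  toFun := constacyclicShift a
  map_add' c d := by
    ext i
    by_cases h : (i : ℕ) = 0 <;> simp [constacyclicShift, h, mul_add]
  map_smul' t c := by
    ext i
    by_cases h : (i : ℕ) = 0 <;> simp [constacyclicShift, h, mul_left_comm]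

theorem wordEval_aeval_constacyclicShiftLin {x : K} (hx : x ^ n = algebraMap F K a)
    (p : Polynomial F) (c : Fin n → F) :
    wordEval x (Polynomial.aeval (constacyclicShiftLin n a) p c) =
      Polynomial.aeval x p * wordEval x c := by
  induction p using Polynomial.induction_on' generalizing c with
  | add p q hp hq => simp only [map_add, LinearMap.add_apply, hp, hq, add_mul]
  | monomial k t =>
    simp only [Polynomial.aeval_monomial, Module.End.mul_apply, Module.algebraMap_end_apply,
      map_smul]
    rw [Algebra.smul_def, mul_assoc]
    congr 1
    induction k generalizing c with
    | zero => simp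
    | succ k ih =>
      rw [pow_succ, Module.End.mul_apply, ih, pow_succ, mul_assoc]
      congr 1
      exact wordEval_constacyclicShift hx c

theorem IsConstacyclic.aeval_mem {C : Submodule F (Fin n → F)} (hC : IsConstacyclic a C)
    (p : Polynomial F) {c : Fin n → F} (hc : c ∈ C) :
    Polynomial.aeval (constacyclicShiftLin n a) p c ∈ C := by
  induction p using Polynomial.induction_on' with
  | add p q hp hq => simpa using C.add_mem hp hq
  | monomial k t =>
    simp only [Polynomial.aeval_monomial, Module.End.mul_apply, Module.algebraMap_end_apply]
    refine C.smul_mem t ?_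
    induction k with
    | zero => simpa
    | succ k ih =>
      rw [pow_succ', Module.End.mul_apply]
      exact hC _ ih

variable (b) in
/-- The support of a constacyclic code is the set of the roots at which some codeword does not
vanish. The polynomials `p` with `p · 1 ∈ C` form an ideal `(g)` with `g ∣ xⁿ - a`, and the support
of `C` is the root set of `h = (xⁿ - a) / g`. If `p` vanishes off the support, then `p h` vanishes
at all roots of `xⁿ - a = g h`, so `g ∣ p`. -/
theorem IsConstacyclic.eq_codeOfSupport [IsAlgClosed K] [NeZero n] (hn : (n : K) ≠ 0)
    (hb : (b : K) = algebraMap F K a) {C : Submodule F (Fin n → F)} (hC : IsConstacyclic a C) :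
    C = codeOfSupport F {β : UnitRoots n b | ∃ c ∈ C, wordEval (β.1 : K) c ≠ 0} := by
  apply le_antisymm
  · intro c hc
    rw [mem_codeOfSupport]
    intro β hβ
    by_contra h
    exact hβ ⟨c, hc, h⟩
  intro c hc
  rw [mem_codeOfSupport] at hc
  let T := constacyclicShiftLin n a
  let one : Fin n → F := Pi.single 0 1
  have hone (x : K) : wordEval x one = 1 := by
    simp [wordEval_apply, one, Pi.single_apply]
  let poly : (Fin n → F) → Polynomial F := fun c =>
    ∑ i : Fin n, Polynomial.monomial (i : ℕ) (c i)
  have hpoly (c : Fin n → F) (x : K) : Polynomial.aeval x (poly c) = wordEval x c := by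
    simp [poly, wordEval_apply]
  have hpoly_one (c : Fin n → F) : Polynomial.aeval T (poly c) one = c :=
    eq_of_wordEval_eq b hn fun β => by
      rw [wordEval_aeval_constacyclicShiftLin (UnitRoots.pow_eq hb β), hpoly, hone, mul_one]
  -- `one` is the word `(1, 0, …, 0)`, on which the shift acts as on `1 ∈ F[x] / (xⁿ - a)`.
  let I : Ideal (Polynomial F) :=
    { carrier := {p | Polynomial.aeval T p one ∈ C}
      zero_mem' := by simp
      add_mem' := fun {p q} hp hq => by
        have := C.add_mem hp hq
        simpa using this
      smul_mem' := fun r p hp => by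
        have := hC.aeval_mem r hp
        simpa [Module.End.mul_apply] using this }
  have hpolyI {c : Fin n → F} (hc : c ∈ C) : poly c ∈ I := by
    change Polynomial.aeval T (poly c) one ∈ C
    rwa [hpoly_one]
  obtain ⟨g, hg⟩ := (IsPrincipalIdealRing.principal I).principal
  have hgI (p : Polynomial F) : p ∈ I ↔ g ∣ p := by
    rw [hg]; exact Ideal.mem_span_singleton
  let f : Polynomial F := Polynomial.X ^ n - Polynomial.C a
  have hf (β : UnitRoots n b) : Polynomial.aeval (β.1 : K) f = 0 := by
    simp [f, UnitRoots.pow_eq hb β]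
  have hfI : f ∈ I := by
    change Polynomial.aeval T f one ∈ C
    rw [eq_of_wordEval_eq b hn (c := Polynomial.aeval T f one) (c' := 0) fun β => by
      rw [wordEval_aeval_constacyclicShiftLin (UnitRoots.pow_eq hb β), hf, zero_mul, map_zero]]
    exact C.zero_mem
  obtain ⟨h, hgh⟩ := (hgI f).1 hfI
  have hh : h ≠ 0 := by
    rintro rfl
    exact Polynomial.X_pow_sub_C_ne_zero (NeZero.pos n) a (by rw [mul_zero] at hgh; exact hgh)
  have hdvd : f ∣ poly c * h := by
    refine X_pow_sub_C_dvd_of_aeval_eq_zero (b := b) hn hb fun β => ?_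
    rw [map_mul]
    by_cases hβ : ∃ c ∈ C, wordEval (β.1 : K) c ≠ 0
    · obtain ⟨d, hd, hd0⟩ := hβ
      obtain ⟨s, hs⟩ := (hgI _).1 (hpolyI hd)
      have hg0 : Polynomial.aeval (β.1 : K) g ≠ 0 := by
        intro h0
        apply hd0
        rw [← hpoly, hs, map_mul, h0, zero_mul]
      have := hf β
      rw [hgh, map_mul] at this
      rw [(mul_eq_zero.1 this).resolve_left hg0, mul_zero]
    · rw [hpoly, hc β hβ, zero_mul]
  rw [hgh] at hdvd
  have hc' : poly c ∈ I := (hgI _).2 ((mul_dvd_mul_iff_right hh).1 hdvd)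
  rw [← hpoly_one c]
  exact hc'

end

theorem codeOfSupport_injOn {F K : Type*} [Field F] [Fintype F] [Field K] [Algebra F K]
    {n : ℕ} [NeZero n] {b : Kˣ} (hn : (n : K) ≠ 0)
    {τ : Equiv.Perm (UnitRoots n b)} (hτ : ∀ β, (τ β).1 = β.1 ^ Fintype.card F) :
    Set.InjOn (codeOfSupport F) {U : Set (UnitRoots n b) | ∀ β, τ β ∈ U ↔ β ∈ U} := by
  classical
  have key (U V : Set (UnitRoots n b)) (hU : ∀ β, τ β ∈ U ↔ β ∈ U)
      (h : codeOfSupport F U ≤ codeOfSupport F V) : U ⊆ V := by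
    intro β hβ
    by_contra hβV
    obtain ⟨e, he⟩ := exists_wordEval_eq_indicator hn hτ hU
    have h1 : e ∈ codeOfSupport F U := mem_codeOfSupport.2 fun γ hγ => by rw [he, if_neg hγ]
    have h2 := mem_codeOfSupport.1 (h h1) β hβV
    rw [he, if_pos hβ] at h2
    exact one_ne_zero h2
  intro U hU V hV h
  exact (key U V hU h.le).antisymm (key V U hV h.ge)

/-! ### Invariant sets of a permutation -/

/-- Sending an invariant set to its set of orbits is a bijection. -/
theorem card_invariant_sets {X : Type*} [Finite X] (σ : Equiv.Perm X) :
    Nat.card {U : Set X // ∀ x, σ x ∈ U ↔ x ∈ U} =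
      2 ^ Nat.card (MulAction.orbitRel.Quotient (Subgroup.zpowers σ) X) := by
  classical
  have := Fintype.ofFinite X
  let π : X → MulAction.orbitRel.Quotient (Subgroup.zpowers σ) X := Quotient.mk''
  have hinv (U : Set X) (hU : ∀ x, σ x ∈ U ↔ x ∈ U) (τ : Subgroup.zpowers σ) (x : X) :
      τ • x ∈ U ↔ x ∈ U := by
    obtain ⟨τ, k, rfl⟩ := τ
    change (σ ^ k) x ∈ U ↔ x ∈ U
    induction k generalizing x with
    | zero => simp
    | succ k ih => rw [zpow_add_one, Equiv.Perm.mul_apply, ih, hU]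
    | pred k ih =>
      rw [zpow_sub_one, Equiv.Perm.mul_apply, ih, ← hU]
      simp
  let e : {U : Set X // ∀ x, σ x ∈ U ↔ x ∈ U} ≃
      Set (MulAction.orbitRel.Quotient (Subgroup.zpowers σ) X) :=
    { toFun U := π '' U.1
      invFun V := ⟨π ⁻¹' V, fun x => by
        have : π (σ x) = π x := Quotient.sound'
          (MulAction.orbitRel_apply.2 ⟨⟨σ, Subgroup.mem_zpowers σ⟩, rfl⟩)
        simp only [Set.mem_preimage, this]⟩
      left_inv U := by
        ext x
        refine ⟨?_, fun h => ⟨x, h, rfl⟩⟩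
        rintro ⟨y, hy, hxy⟩
        obtain ⟨τ, rfl⟩ := MulAction.orbitRel_apply.1 (Quotient.exact' hxy)
        exact (hinv U.1 U.2 τ x).1 hy
      right_inv V := Set.image_preimage_eq _ Quotient.mk''_surjective }
  rw [Nat.card_congr e, Nat.card_eq_fintype_card, Fintype.card_set, Nat.card_eq_fintype_card]

/-- The points of an orbit with `s` elements contribute `s · (1 / s) = 1`. -/
theorem card_orbits_eq_sum_inv_minimalPeriod {X : Type*} [Fintype X] (σ : Equiv.Perm X) :
    (Nat.card (MulAction.orbitRel.Quotient (Subgroup.zpowers σ) X) : ℚ) =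
      ∑ x, ((Function.minimalPeriod σ x : ℕ) : ℚ)⁻¹ := by
  classical
  let π : X → MulAction.orbitRel.Quotient (Subgroup.zpowers σ) X := Quotient.mk''
  rw [← Finset.sum_fiberwise Finset.univ π, Nat.card_eq_fintype_card, ← Finset.card_univ,
    Finset.card_eq_sum_ones, Nat.cast_sum]
  refine Finset.sum_congr rfl fun ω _ => ?_
  induction ω using Quotient.inductionOn' with
  | h x =>
  have hper (y : X) : Function.minimalPeriod σ y =
      (Finset.univ.filter fun z => π z = π y).card := by
    have h := MulAction.minimalPeriod_eq_card (a := σ) (b := y)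
    rw [show (Function.minimalPeriod (fun x => σ • x) y) = Function.minimalPeriod σ y from rfl] at h
    rw [h, Fintype.card_subtype]
    congr 1
    ext z
    simp only [Finset.mem_filter, Finset.mem_univ, true_and]
    rw [← MulAction.orbitRel_apply]
    exact Quotient.eq''.symm
  have hpos : (Finset.univ.filter fun z => π z = π x).card ≠ 0 :=
    Finset.card_ne_zero.2 ⟨x, by simp⟩
  rw [Finset.sum_congr rfl
    (g := fun _ => (((Finset.univ.filter fun z => π z = π x).card : ℕ) : ℚ)⁻¹)]
  · rw [Finset.sum_const, nsmul_eq_mul]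
    change _ = ((Finset.univ.filter fun z => π z = π x).card : ℚ) * _
    rw [mul_inv_cancel₀ (by exact_mod_cast hpos), Nat.cast_one]
  · intro y hy
    have hy' : π y = π x := (Finset.mem_filter.1 hy).2
    rw [hper, hy']

/-! ### The Hermitian form and supports of LCD codes -/

/-- The square of `β ↦ β ^ (-q)` is the Frobenius map of `F`. -/
theorem UnitRoots.perm_mul_self_apply {F K : Type*} [Fintype F] [Field K] {n q : ℕ} {b : Kˣ}
    {σ : Equiv.Perm (UnitRoots n b)} (hF : Fintype.card F = q ^ 2) (hσ : ∀ β, (σ β).1 = (β.1 ^ q)⁻¹)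
    (β : UnitRoots n b) :
    ((σ * σ) β).1 = β.1 ^ Fintype.card F := by
  rw [Equiv.Perm.mul_apply, hσ, hσ, inv_pow, inv_inv, ← pow_mul, hF, sq]

section
variable {F K : Type*} [Field F] [Field K] [Algebra F K] {n p k q : ℕ} {a : F} {b : Kˣ}
  [ExpChar K p]

/-- The map `β ↦ β ^ (-q)` maps the `n`-th roots of `b` to those of `b ^ (-q) = b`, and it is
injective since the Frobenius map is. -/
theorem UnitRoots.exists_inv_pow_perm [NeZero n] (hq : q = p ^ k) (hb : b ^ (q + 1) = 1) :
    ∃ σ : Equiv.Perm (UnitRoots n b), ∀ β, (σ β).1 = (β.1 ^ q)⁻¹ := by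
  let s : UnitRoots n b → UnitRoots n b := fun β => ⟨(β.1 ^ q)⁻¹, by
    rw [inv_pow, pow_right_comm, β.2, inv_eq_iff_mul_eq_one, ← pow_succ, hb]⟩
  have hs : Function.Injective s := by
    intro β γ h
    have h1 : β.1 ^ q = γ.1 ^ q := inv_injective (congrArg Subtype.val h)
    apply Subtype.ext
    apply Units.ext
    apply (iterateFrobenius K p k).injective
    have h2 := congrArg Units.val h1
    rw [hq] at h2
    simpa [iterateFrobenius_def] using h2
  exact ⟨Equiv.ofBijective s (Finite.injective_iff_bijective.1 hs), fun β => rfl⟩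

theorem wordEval_pow_eq_sum (hq : q = p ^ k) (x : K) (c : Fin n → F) :
    wordEval x c ^ q = ∑ i, algebraMap F K (c i ^ q) * (x ^ q) ^ (i : ℕ) := by
  rw [wordEval_apply, hq]
  have h := map_sum (iterateFrobenius K p k) (fun i => algebraMap F K (c i) * x ^ (i : ℕ))
    Finset.univ
  simp only [iterateFrobenius_def] at h
  rw [h]
  refine Finset.sum_congr rfl fun i _ => ?_
  rw [mul_pow, map_pow, pow_right_comm]

/-- Parseval's identity for the Hermitian form. -/
theorem natCast_mul_hermitianInner [IsAlgClosed K] [NeZero n] (hn : (n : K) ≠ 0)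
    (hq : q = p ^ k) {σ : Equiv.Perm (UnitRoots n b)} (hσ : ∀ β, (σ β).1 = (β.1 ^ q)⁻¹)
    (u v : Fin n → F) :
    (n : K) * algebraMap F K (hermitianInner q u v) =
      ∑ β : UnitRoots n b, wordEval ((σ β).1 : K) u * wordEval (β.1 : K) v ^ q := by
  have h (j : Fin n) : (n : K) * algebraMap F K (u j) =
      ∑ β : UnitRoots n b, wordEval ((σ β).1 : K) u * ((β.1 : K) ^ q) ^ (j : ℕ) := by
    rw [natCast_mul_coeff_eq_sum_wordEval (b := b) hn, ← Equiv.sum_comp σ]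
    refine Finset.sum_congr rfl fun β _ => ?_
    rw [div_eq_mul_inv]
    congr 1
    rw [hσ, Units.val_inv_eq_inv_val, inv_pow, inv_inv, Units.val_pow_eq_pow_val]
  simp only [hermitianInner, map_sum, map_mul, Finset.mul_sum, ← mul_assoc, h,
    wordEval_pow_eq_sum hq]
  simp only [Finset.sum_mul]
  rw [Finset.sum_comm]
  refine Finset.sum_congr rfl fun β _ => Finset.sum_congr rfl fun i _ => ?_
  ring

end

section
variable {F K : Type*} [Field F] [Fintype F] [Field K] [Algebra F K] [IsAlgClosed K]
  {n p k q : ℕ} [NeZero n] {a : F} {b : Kˣ} [ExpChar K p]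

/-- If `c` has support in `U` and `e` is the word with transform `1_U`, then `⟨c, T ^ j e⟩ = c_j` by
Parseval's identity and Fourier inversion, where `T` is the shift. If `c` is also orthogonal to the
code, which contains all `T ^ j e`, then `c = 0`. -/
theorem isHermitianLCD_codeOfSupport (hn : (n : K) ≠ 0) (hq : q = p ^ k)
    (hF : Fintype.card F = q ^ 2) (hb : (b : K) = algebraMap F K a)
    {σ : Equiv.Perm (UnitRoots n b)} (hσ : ∀ β, (σ β).1 = (β.1 ^ q)⁻¹)
    {U : Set (UnitRoots n b)} (hU : ∀ β, σ β ∈ U ↔ β ∈ U) :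
    IsHermitianLCD q (codeOfSupport F U) := by
  classical
  rw [IsHermitianLCD, Submodule.eq_bot_iff]
  rintro c ⟨hc, hc'⟩
  rw [SetLike.mem_coe, mem_codeOfSupport] at hc
  obtain ⟨e, he⟩ := exists_wordEval_eq_indicator hn (UnitRoots.perm_mul_self_apply hF hσ) (U := U)
    fun β => by rw [Equiv.Perm.mul_apply, hU, hU]
  have heU : e ∈ codeOfSupport F U := mem_codeOfSupport.2 fun β hβ => by rw [he, if_neg hβ]
  ext j
  let v := Polynomial.aeval (constacyclicShiftLin n a) (Polynomial.X ^ (j : ℕ) : Polynomial F) e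
  have hv : v ∈ codeOfSupport F U := (isConstacyclic_codeOfSupport hb U).aeval_mem _ heU
  have h := natCast_mul_hermitianInner (K := K) hn hq hσ c v
  rw [hc' v hv, map_zero, mul_zero] at h
  have h2 := natCast_mul_coeff_eq_sum_wordEval (b := b) hn c j
  rw [← Equiv.sum_comp σ] at h2
  have h3 : (n : K) * algebraMap F K (c j) = 0 := by
    rw [h2, h]
    refine Finset.sum_congr rfl fun β _ => ?_
    by_cases hβ : β ∈ U
    · rw [wordEval_aeval_constacyclicShiftLin (UnitRoots.pow_eq hb β), he, if_pos hβ, mul_one,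
        div_eq_mul_inv, hσ]
      simp [pow_right_comm]
    · rw [hc (σ β) (by rwa [hU]), zero_mul, zero_div]
  simpa [hn] using h3

/-- The word with transform the indicator function of `U \ σ U` lies in the code and in its dual, so
`U ⊆ σ U`; as `σ²` preserves `U`, this is an equality. -/
theorem mem_iff_of_isHermitianLCD_codeOfSupport (hn : (n : K) ≠ 0) (hq : q = p ^ k)
    (hF : Fintype.card F = q ^ 2)
    {σ : Equiv.Perm (UnitRoots n b)} (hσ : ∀ β, (σ β).1 = (β.1 ^ q)⁻¹)
    {U : Set (UnitRoots n b)} (hU : ∀ β, (σ * σ) β ∈ U ↔ β ∈ U)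
    (h : IsHermitianLCD q (codeOfSupport F U)) (β : UnitRoots n b) : σ β ∈ U ↔ β ∈ U := by
  classical
  have key (β : UnitRoots n b) (hβ : σ β ∈ U) : β ∈ U := by
    by_contra hβU
    obtain ⟨e, he⟩ := exists_wordEval_eq_indicator hn (UnitRoots.perm_mul_self_apply hF hσ)
      (U := {γ | γ ∈ U ∧ σ.symm γ ∉ U}) fun γ => by
        have h1 := hU (σ.symm γ)
        simp only [Equiv.Perm.mul_apply, Equiv.apply_symm_apply] at h1
        have h2 := hU γ
        simp only [Equiv.Perm.mul_apply] at h2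
        simp only [Set.mem_ofPred_eq, Equiv.Perm.mul_apply, Equiv.symm_apply_apply, h1, h2]
    have heU : e ∈ codeOfSupport F U := mem_codeOfSupport.2 fun γ hγ => by
      rw [he, if_neg fun h => hγ h.1]
    have heD : e ∈ hermitianDual q (codeOfSupport F U) := by
      intro v hv
      rw [mem_codeOfSupport] at hv
      apply (algebraMap F K).injective
      apply mul_left_cancel₀ hn
      rw [natCast_mul_hermitianInner hn hq hσ, map_zero, mul_zero]
      refine Finset.sum_eq_zero fun γ _ => ?_
      by_cases hγ : γ ∈ U
      · rw [he, if_neg fun h => h.2 (by simpa using hγ), zero_mul]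
      · have hq0 : q ≠ 0 := by
          rintro rfl
          exact Fintype.card_ne_zero hF
        rw [hv γ hγ, zero_pow hq0, mul_zero]
    have he0 : e = 0 := (Submodule.eq_bot_iff _).1 h e ⟨heU, heD⟩
    have := he (σ β)
    rw [he0, map_zero, if_pos ⟨hβ, by simpa using hβU⟩] at this
    exact zero_ne_one this
  exact ⟨key β, fun hβ => key (σ β) ((hU β).2 hβ)⟩

theorem ncard_isConstacyclic_isHermitianLCD (hn : (n : K) ≠ 0) (hq : q = p ^ k)
    (hF : Fintype.card F = q ^ 2) (hb : (b : K) = algebraMap F K a)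
    {σ : Equiv.Perm (UnitRoots n b)} (hσ : ∀ β, (σ β).1 = (β.1 ^ q)⁻¹) :
    {C : Submodule F (Fin n → F) | IsConstacyclic a C ∧ IsHermitianLCD q C}.ncard =
      2 ^ Nat.card (MulAction.orbitRel.Quotient (Subgroup.zpowers σ) (UnitRoots n b)) := by
  have hσσ := UnitRoots.perm_mul_self_apply hF hσ
  rw [← card_invariant_sets]
  have himage : {C : Submodule F (Fin n → F) | IsConstacyclic a C ∧ IsHermitianLCD q C} =
      codeOfSupport F '' {U : Set (UnitRoots n b) | ∀ β, σ β ∈ U ↔ β ∈ U} := by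
    ext C
    constructor
    · rintro ⟨hC, hLCD⟩
      have h := hC.eq_codeOfSupport b hn hb
      refine ⟨_, ?_, h.symm⟩
      rw [h] at hLCD
      refine mem_iff_of_isHermitianLCD_codeOfSupport hn hq hF hσ (fun β => ?_) hLCD
      simp only [Set.mem_ofPred_eq]
      rw [hσσ, Units.val_pow_eq_pow_val]
      simp only [wordEval_pow_card, ne_eq, pow_eq_zero_iff Fintype.card_ne_zero]
    · rintro ⟨U, hU, rfl⟩
      exact ⟨isConstacyclic_codeOfSupport hb U, isHermitianLCD_codeOfSupport hn hq hF hb hσ hU⟩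
  rw [himage, Set.InjOn.ncard_image]
  · rfl
  · refine (codeOfSupport_injOn hn hσσ).mono ?_
    intro U hU
    rw [Set.mem_ofPred_eq] at hU ⊢
    intro β
    rw [Equiv.Perm.mul_apply, hU, hU]

end

/-! ### Orders of the roots and orbit sizes -/

/-- The `k`-th iterate of `σ` is `β ↦ β ^ ((-q) ^ k)`. -/
theorem minimalPeriod_eq_orderOf_neg {K : Type*} [Field K] {n q : ℕ} {b : Kˣ}
    {σ : Equiv.Perm (UnitRoots n b)} (hσ : ∀ β, (σ β).1 = (β.1 ^ q)⁻¹) (β : UnitRoots n b) :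
    Function.minimalPeriod σ β = orderOf (-(q : ZMod (orderOf β.1))) := by
  have hiter (k : ℕ) : (σ^[k] β).1 = β.1 ^ ((-(q : ℤ)) ^ k) := by
    induction k with
    | zero => simp
    | succ k ih =>
      rw [Function.iterate_succ_apply', hσ, ih, ← zpow_natCast, ← zpow_mul, ← zpow_neg, pow_succ,
        mul_neg]
  rw [orderOf, Function.minimalPeriod_eq_minimalPeriod_iff]
  intro k
  rw [isPeriodicPt_mul_iff_pow_eq_one, Function.IsPeriodicPt, Function.IsFixedPt, Subtype.ext_iff,
    hiter]
  nth_rewrite 2 [← zpow_one β.1]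
  rw [zpow_eq_zpow_iff_modEq, ← ZMod.intCast_eq_intCast_iff]
  simp

open Classical in
/-- The order of `q² = (-q)²` is that of `-q` or half of it according to whether the order of `-q` is
odd, which is equivalent to `q ^ w = -1` for an odd `w`. If `-q` has infinite order, recorded as
`0`, all the inverses are `0`. -/
theorem inv_orderOf_neg_natCast (m q : ℕ) :
    ((orderOf (-(q : ZMod m)) : ℕ) : ℚ)⁻¹ =
      (((orderOf ((q : ZMod m) ^ 2) : ℕ) : ℚ)⁻¹ +
        if ∃ w : ℕ, Odd w ∧ (q : ℤ) ^ w ≡ -1 [ZMOD (m : ℤ)] then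
          ((orderOf ((q : ZMod m) ^ 2) : ℕ) : ℚ)⁻¹ else 0) / 2 := by
  have hT : (∃ w : ℕ, Odd w ∧ (q : ℤ) ^ w ≡ -1 [ZMOD (m : ℤ)]) ↔
      Odd (orderOf (-(q : ZMod m))) := by
    have h (w : ℕ) (hw : Odd w) :
        (q : ℤ) ^ w ≡ -1 [ZMOD (m : ℤ)] ↔ (-(q : ZMod m)) ^ w = 1 := by
      rw [← ZMod.intCast_eq_intCast_iff, hw.neg_pow]
      push_cast
      exact ⟨fun h => by rw [h, neg_neg], fun h => by rw [← h, neg_neg]⟩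
    constructor
    · rintro ⟨w, hw, hqw⟩
      exact hw.of_dvd_nat (orderOf_dvd_of_pow_eq_one ((h w hw).1 hqw))
    · intro hodd
      exact ⟨_, hodd, (h _ hodd).2 (pow_orderOf_eq_one _)⟩
  have hord := orderOf_pow' (-(q : ZMod m)) two_ne_zero
  rw [neg_sq] at hord
  simp only [hT]
  split_ifs with h
  · rw [hord, (Nat.coprime_two_right.2 h : Nat.gcd _ 2 = 1), Nat.div_one]
    ring
  · obtain ⟨t, ht⟩ := (Nat.not_odd_iff_even.1 h).two_dvd
    rw [hord, ht, Nat.gcd_eq_right (Dvd.intro t rfl), Nat.mul_div_cancel_left t two_pos]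
    push_cast
    rw [mul_inv]
    ring

theorem orderOf_eq_mul_of_pow_eq {G : Type*} [Monoid G] {u μ : G} {m : ℕ} (hm : m ≠ 0)
    (hu : u ^ m = μ) (hμ : 0 < orderOf μ)
    (hdvd : ∀ p : ℕ, p.Prime → p ∣ m → p ∣ orderOf μ) : orderOf u = orderOf μ * m := by
  refine orderOf_eq_of_pow_and_pow_div_prime (Nat.mul_pos hμ (Nat.pos_of_ne_zero hm)) ?_ ?_
  · rw [mul_comm, pow_mul, hu, pow_orderOf_eq_one]
  · intro p hp hpd h1
    have hpr : p ∣ orderOf μ := (hp.dvd_mul.1 hpd).elim id (hdvd p hp)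
    rw [← Nat.div_mul_right_comm hpr, mul_comm, pow_mul, hu] at h1
    exact absurd (Nat.le_of_dvd (Nat.div_pos (Nat.le_of_dvd hμ hpr) hp.pos)
      (orderOf_dvd_of_pow_eq_one h1)) (not_le.2 (Nat.div_lt_self hμ hp.one_lt))

theorem sum_rootsOfUnity_orderOf {K : Type*} [Field K] [IsAlgClosed K] {m : ℕ} [NeZero m]
    [Fintype (rootsOfUnity m K)] (hm : (m : K) ≠ 0) (g : ℕ → ℚ) :
    ∑ z : rootsOfUnity m K, g (orderOf z) = ∑ d ∈ m.divisors, (Nat.totient d : ℚ) * g d := by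
  classical
  have : NeZero (m : K) := ⟨hm⟩
  have hcard : Fintype.card (rootsOfUnity m K) = m := by
    rw [← Nat.card_eq_fintype_card, HasEnoughRootsOfUnity.natCard_rootsOfUnity]
  rw [← Finset.sum_fiberwise_of_maps_to (t := m.divisors) (g := fun z => orderOf z)]
  · refine Finset.sum_congr rfl fun d hd => ?_
    rw [Finset.sum_congr rfl (g := fun _ => g d) fun z hz => by rw [(Finset.mem_filter.1 hz).2],
      Finset.sum_const, nsmul_eq_mul]
    rw [IsCyclic.card_orderOf_eq_totient (by rw [hcard]; exact Nat.dvd_of_mem_divisors hd)]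
  · intro z _
    rw [Nat.mem_divisors]
    refine ⟨?_, NeZero.ne m⟩
    have := orderOf_dvd_card (x := z)
    rwa [hcard] at this

/-- As `n₂` is prime to the order `r` of `b`, we have `b = μ ^ n₂` for a power `μ` of `b`. The roots are
then uniquely the products of an `n₁`-th root of `μ`, of order `r n₁`, and an `n₂`-th root of unity,
whose order is prime to `r n₁`. -/
theorem UnitRoots.sum_orderOf {K : Type*} [Field K] [IsAlgClosed K] {n n₁ n₂ : ℕ} [NeZero n]
    {b : Kˣ} (hn : (n : K) ≠ 0) (hmul : n = n₁ * n₂) (hb : 0 < orderOf b)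
    (h₁ : ∀ p : ℕ, p.Prime → p ∣ n₁ → p ∣ orderOf b) (h₂ : Nat.Coprime n₂ (orderOf b))
    (f : ℕ → ℚ) :
    ∑ β : UnitRoots n b, f (orderOf β.1) =
      n₁ * ∑ d ∈ n₂.divisors, (Nat.totient d : ℚ) * f (orderOf b * d * n₁) := by
  have hn₁ : n₁ ≠ 0 := by rintro rfl; exact NeZero.ne n (by simpa using hmul)
  have hn₂ : n₂ ≠ 0 := by rintro rfl; exact NeZero.ne n (by simpa using hmul)
  have : NeZero n₁ := ⟨hn₁⟩
  have : NeZero n₂ := ⟨hn₂⟩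
  have hK₁ : (n₁ : K) ≠ 0 := by rintro h; apply hn; rw [hmul, Nat.cast_mul, h, zero_mul]
  have hK₂ : (n₂ : K) ≠ 0 := by rintro h; apply hn; rw [hmul, Nat.cast_mul, h, mul_zero]
  have : NeZero (n₂ : K) := ⟨hK₂⟩
  have := Fintype.ofFinite (rootsOfUnity n₂ K)
  obtain ⟨s, hs⟩ := exists_pow_eq_self_of_coprime h₂
  have hμ : (b ^ s) ^ n₂ = b := by rw [pow_right_comm, hs]
  have hμr : orderOf (b ^ s) = orderOf b := Nat.dvd_antisymm (orderOf_pow_dvd s) (by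
    conv_lhs => rw [← hμ]
    exact orderOf_pow_dvd n₂)
  have hcop : Nat.Coprime n₁ n₂ := Nat.coprime_of_dvd fun p hp h h' =>
    hp.one_lt.ne' (Nat.dvd_one.1 (h₂ ▸ Nat.dvd_gcd h' (h₁ p hp h)))
  have hu (u : UnitRoots n₁ (b ^ s)) : orderOf u.1 = orderOf b * n₁ := by
    rw [orderOf_eq_mul_of_pow_eq hn₁ u.2 (by rwa [hμr]) (by rwa [hμr]), hμr]
  let Φ : UnitRoots n₁ (b ^ s) × rootsOfUnity n₂ K → UnitRoots n b := fun x =>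
    ⟨x.1.1 * x.2.1, by
      have h := (mem_rootsOfUnity _ _).1 x.2.2
      rw [mul_pow, hmul, pow_mul, x.1.2, hμ, mul_comm n₁, pow_mul, h, one_pow, mul_one]⟩
  have hinj : Function.Injective Φ := by
    rintro ⟨u, z⟩ ⟨u', z'⟩ h
    have h0 : u.1 * z.1 = u'.1 * z'.1 := congrArg Subtype.val h
    have h1 : u.1 / u'.1 = z'.1 / z.1 := by
      rw [div_eq_div_iff_mul_eq_mul, h0, mul_comm]
    have e1 : (u.1 / u'.1) ^ n₁ = 1 := by rw [div_pow, u.2, u'.2, div_self']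
    have e2 : (u.1 / u'.1) ^ n₂ = 1 := by
      rw [h1, div_pow, (mem_rootsOfUnity _ _).1 z.2, (mem_rootsOfUnity _ _).1 z'.2, div_one]
    have e3 : u.1 / u'.1 = 1 := by
      rw [← pow_one (u.1 / u'.1), ← hcop.gcd_eq_one]
      exact pow_gcd_eq_one.2 ⟨e1, e2⟩
    have e4 : z'.1 / z.1 = 1 := h1 ▸ e3
    exact Prod.ext (Subtype.ext (div_eq_one.1 e3)) (Subtype.ext (div_eq_one.1 e4).symm)
  have hbij : Function.Bijective Φ := by
    rw [Nat.bijective_iff_injective_and_card]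
    refine ⟨hinj, ?_⟩
    rw [Nat.card_prod, UnitRoots.card_eq hK₁, HasEnoughRootsOfUnity.natCard_rootsOfUnity,
      UnitRoots.card_eq hn, hmul]
  rw [← hbij.sum_comp (fun β : UnitRoots n b => f (orderOf β.1)), Fintype.sum_prod_type]
  have hterm (u : UnitRoots n₁ (b ^ s)) (z : rootsOfUnity n₂ K) :
      orderOf (Φ (u, z)).1 = orderOf b * orderOf z * n₁ := by
    have hz : orderOf z.1 ∣ n₂ := orderOf_dvd_of_pow_eq_one ((mem_rootsOfUnity _ _).1 z.2)
    change orderOf (u.1 * z.1) = _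
    rw [(Commute.all _ _).orderOf_mul_eq_mul_orderOf_of_coprime, hu, Subgroup.orderOf_coe]
    · ring
    · rw [hu]
      exact (Nat.Coprime.mul_left h₂.symm hcop).coprime_dvd_right hz
  simp only [hterm, sum_rootsOfUnity_orderOf hK₂ (fun d => f (orderOf b * d * n₁)),
    Finset.sum_const, Finset.card_univ, ← Nat.card_eq_fintype_card, UnitRoots.card_eq hK₁,
    nsmul_eq_mul]

/-! ### The count of Hermitian LCD codes -/

theorem theorem3p8 {F : Type*} [Field F] [Fintype F] (q : ℕ) (hq : IsPrimePow q)
    (hF : Fintype.card F = q ^ 2) (n : ℕ) (hn : 0 < n) (hnq : Nat.gcd n q = 1) (lam : Fˣ) :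
    (lam ^ (q + 1) ≠ 1 →
      ∀ C : Submodule F (Fin n → F), IsConstacyclic (lam : F) C → IsHermitianLCD q C) ∧
    (lam ^ (q + 1) = 1 →
      ∀ n₁ n₂ : ℕ, n = n₁ * n₂ →
        UniqueFactorizationMonoid.radical n₁ ∣ UniqueFactorizationMonoid.radical (orderOf lam) →
        Nat.gcd n₂ (orderOf lam) = 1 →
        (({C : Submodule F (Fin n → F) |
            IsConstacyclic (lam : F) C ∧ IsHermitianLCD q C}.ncard : ℕ) : ℝ) =
          (2 : ℝ) ^ (((countM1 q (orderOf lam) n₁ n₂ + countM2 q (orderOf lam) n₁ n₂) / 2 : ℚ)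
            : ℝ)) := by
  classical
  obtain ⟨p, k, hp, hk, rfl⟩ := hq
  have hp : p.Prime := hp.nat_prime
  have : Fact p.Prime := ⟨hp⟩
  have hcard : Fintype.card F = p ^ (k * 2) := by rw [hF, pow_mul]
  have hchar : CharP F p := charP_of_card_eq_prime_pow hcard
  refine ⟨fun hlam C hC => ?_, fun hlam n₁ n₂ hmul hrad hcop => ?_⟩
  · obtain ⟨m, rfl⟩ := Nat.exists_eq_succ_of_ne_zero hn.ne'
    have hexp : ExpChar F p := ExpChar.prime hp
    refine isHermitianLCD_of_pow_ne_one (p := p) rfl hF lam.ne_zero (fun h => hlam ?_) hC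
    exact Units.ext (by simpa using h)
  have : NeZero n := ⟨hn.ne'⟩
  let K := AlgebraicClosure F
  have hcharK : CharP K p := charP_of_injective_algebraMap (algebraMap F K).injective p
  have hexp : ExpChar K p := ExpChar.prime hp
  have hnK : (n : K) ≠ 0 := by
    rw [Ne, CharP.cast_eq_zero_iff K p]
    intro h
    exact hp.one_lt.ne' (Nat.dvd_one.1 (hnq ▸ Nat.dvd_gcd h (dvd_pow_self p hk.ne')))
  let b : Kˣ := Units.map (algebraMap F K : F →* K) lam
  have hb : (b : K) = algebraMap F K lam := rfl
  have hord : orderOf b = orderOf lam :=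
    orderOf_injective _ (Units.map_injective (algebraMap F K).injective) lam
  have hbq : b ^ (p ^ k + 1) = 1 := by rw [← map_pow, hlam, map_one]
  obtain ⟨σ, hσ⟩ := UnitRoots.exists_inv_pow_perm (n := n) (p := p) (k := k) rfl hbq
  rw [ncard_isConstacyclic_isHermitianLCD hnK rfl hF hb hσ]
  have hr : 0 < orderOf lam := orderOf_pos lam
  have hdvd (ℓ : ℕ) (hℓ : ℓ.Prime) (h : ℓ ∣ n₁) : ℓ ∣ orderOf b := by
    have hn₁ : n₁ ≠ 0 := by rintro rfl; exact hn.ne' (by simpa using hmul)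
    rw [hord]
    exact ((UniqueFactorizationMonoid.dvd_radical_iff_of_irreducible hℓ hn₁).2 h).trans
      (hrad.trans UniqueFactorizationMonoid.radical_dvd_self)
  have hcount : (Nat.card (MulAction.orbitRel.Quotient (Subgroup.zpowers σ) (UnitRoots n b)) : ℚ) =
      (countM1 (p ^ k) (orderOf lam) n₁ n₂ + countM2 (p ^ k) (orderOf lam) n₁ n₂) / 2 := by
    rw [card_orbits_eq_sum_inv_minimalPeriod]
    simp only [minimalPeriod_eq_orderOf_neg hσ]
    rw [UnitRoots.sum_orderOf hnK hmul (hord ▸ hr) hdvd (hord ▸ hcop)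
      (fun m => ((orderOf (-((p ^ k : ℕ) : ZMod m)) : ℕ) : ℚ)⁻¹), hord]
    rw [countM1, countM2, oddDivisorSet, Finset.sum_filter, ← mul_add, ← Finset.sum_add_distrib,
      mul_div_assoc, Finset.sum_div]
    congr 1
    refine Finset.sum_congr rfl fun d _ => ?_
    rw [inv_orderOf_neg_natCast]
    split_ifs <;> ring
  rw [← hcount, Nat.cast_pow, Rat.cast_natCast, Real.rpow_natCast, Nat.cast_ofNat]
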